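/- All manifolds, maps and tensor fields are smooth ($C^\infty$). A locally product Riemannian manifold $(\bar M,g,F)$ is a Riemannian manifold with a $(1,1)$-tensor field $F$ such that $F^2=I$, $F\neq\pm I$, $g(FU,FV)=g(U,V)$ and $\bar\nabla F=0$, where $\bar\nabla$ is the Levi-Civita connection of $g$. For a submanifold $M$ isometrically immersed in $\bar M$ and $U\in T_pM$, let $TU$ be the component of $FU$ tangent to $M$, and for $c\in[0,1]$ put $\mathcal D^{c}_p=\ker(T_p^2-c^2I)\subseteq T_pM$, $\mathcal D^\perp=\mathcal D^0$, $\mathcal D^T=\mathcal D^1$. We call $M$ skew semi-invariant of order $1$ if there is a constant $\lambda\in(0,1)$ such that at every $p\in M$ the number $\lambda^2$ is an eigenvalue of $T_p^2$ and $T_pM=\mathcal D^\perp_p\oplus\mathcal D^T_p\oplus\mathcal D^{\lambda}_p$, the dimensions of the three summands being independent of $p$; it is proper if moreover $\mathcal D^\perp\neq\{0\}$ and $\mathcal D^T\neq\{0\}$, and hemi-slant if moreover $\mathcal D^\perp\neq\{0\}$ and $\mathcal D^T=\{0\}$. We call $M$ invariant if $F(T_pM)\subseteq T_pM$ for every $p\in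 M$. Theorem 5.3 (integrability of the invariant distribution). Let $M_1$ and $M_T$ be Riemannian manifolds with metrics $g_1,g_T$ and $\dim M_1=q$, $\dim M_T=m$, let $f$ be a positive smooth function on $M_1$, and let the warped product $M=M_1\times_fM_T$, that is, $M_1\times M_T$ with the metric $g_1+f^2g_T$, be isometrically immersed in a locally product Riemannian manifold $\bar M$ of dimension $2q+m$. Suppose that $M$ is a proper skew semi-invariant submanifold of order $1$ of $\bar M$, that $M_1$ (each leaf $M_1\times\{b\}$) is a hemi-slant submanifold of $\bar M$, and that $M_T$ (each fibre $\{a\}\times M_T$) is an invariant submanifold of $\bar M$. Then the invariant distribution $\mathcal D^T$ of $M$ is integrable: it is involutive, and through every point of $M$ passes an integral manifold of $\mathcal D^T$. -/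

import Mathlib

open Manifold Bundle
open scoped ContDiff

noncomputable section

section Ambient

variable {E : Type*} [NormedAddCommGroup E] [NormedSpace ℝ E] [FiniteDimensional ℝ E]
  {H : Type*} [TopologicalSpace H] (J : ModelWithCorners ℝ E H)
  {N : Type*} [TopologicalSpace N] [ChartedSpace H N] [IsManifold J ∞ N]
  [RiemannianBundle (fun x : N => TangentSpace J x)]
  [IsContMDiffRiemannianBundle J ∞ E (fun x : N => TangentSpace J x)]

/-- `cov` is the Levi-Civita connection of the Riemannian manifold `N`:
it is torsion free and compatible with the metric, `u ⟨V, W⟩ = ⟨∇_u V, W⟩ + ⟨V, ∇_u W⟩`.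
In Mathlib `∇_u V` at `x` is written `cov V x u`. -/
def IsLeviCivita (cov : CovariantDerivative J E (fun x : N => TangentSpace J x)) : Prop :=
  cov.torsion = 0 ∧
  ∀ (V W : ∀ x : N, TangentSpace J x) (x : N),
    MDifferentiableAt J J.tangent (fun y => (⟨y, V y⟩ : TangentBundle J N)) x →
    MDifferentiableAt J J.tangent (fun y => (⟨y, W y⟩ : TangentBundle J N)) x →
    ∀ u : TangentSpace J x,
      (mfderiv J 𝓘(ℝ, ℝ) (fun y => (inner ℝ (V y) (W y) : ℝ)) x u : ℝ)
        = inner ℝ (cov V x u) (W x) + inner ℝ (V x) (cov W x u)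

/-- The Riemannian manifold `N` together with the field `F` of endomorphisms of its tangent spaces
is a locally product Riemannian manifold: `F` is a smooth tensor field of type `(1,1)` with
`F² = I`, `F ≠ ± I`, `g (F U, F V) = g (U, V)` and `∇ F = 0` for the Levi-Civita connection,
where `(∇_U F) V = ∇_U (F V) - F (∇_U V)`. -/
structure IsLocallyProductRiemannian
    (F : ∀ x : N, TangentSpace J x →L[ℝ] TangentSpace J x) : Prop where
  smooth : ContMDiff J (J.prod 𝓘(ℝ, E →L[ℝ] E)) ∞
    (fun x => TotalSpace.mk' (E →L[ℝ] E)
      (E := fun x : N => TangentSpace J x →L[ℝ] TangentSpace J x) x (F x))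
  sq_eq : ∀ (x : N) (v : TangentSpace J x), F x (F x v) = v
  ne_id : ¬ ∀ (x : N) (v : TangentSpace J x), F x v = v
  ne_neg_id : ¬ ∀ (x : N) (v : TangentSpace J x), F x v = -v
  inner_eq : ∀ (x : N) (u v : TangentSpace J x), inner ℝ (F x u) (F x v) = inner ℝ u v
  parallel : ∃ cov : CovariantDerivative J E (fun x : N => TangentSpace J x),
    IsLeviCivita J cov ∧
    ∀ (V : ∀ x : N, TangentSpace J x) (x : N),
      MDifferentiableAt J J.tangent (fun y => (⟨y, V y⟩ : TangentBundle J N)) x →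
      ∀ u : TangentSpace J x, cov (fun y => F y (V y)) x u - F x (cov V x u) = 0

end Ambient

section Submanifold

variable {E' : Type*} [NormedAddCommGroup E'] [NormedSpace ℝ E']
  {H' : Type*} [TopologicalSpace H'] (I : ModelWithCorners ℝ E' H')
  {M : Type*} [TopologicalSpace M] [ChartedSpace H' M]
  {E : Type*} [NormedAddCommGroup E] [NormedSpace ℝ E] [FiniteDimensional ℝ E]
  {H : Type*} [TopologicalSpace H] (J : ModelWithCorners ℝ E H)
  {N : Type*} [TopologicalSpace N] [ChartedSpace H N]

/-- The tangent space at `p` of the submanifold given by the immersion `φ : M → N`, as a subspace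
of the tangent space of `N` at `φ p`. -/
def tangentImage (φ : M → N) (p : M) : Submodule ℝ (TangentSpace J (φ p)) :=
  LinearMap.range (mfderiv I J φ p).toLinearMap

/-- The submanifold given by `φ` is invariant: `F` maps each of its tangent spaces to itself. -/
def IsInvariantSubmanifold (φ : M → N)
    (F : ∀ x : N, TangentSpace J x →L[ℝ] TangentSpace J x) : Prop :=
  ∀ (p : M), ∀ v ∈ tangentImage I J φ p, F (φ p) v ∈ tangentImage I J φ p

variable [RiemannianBundle (fun x : N => TangentSpace J x)]

instance tangentImage_hasOrthogonalProjection (φ : M → N) (p : M) :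
    (tangentImage I J φ p).HasOrthogonalProjection :=
  haveI : FiniteDimensional ℝ (TangentSpace J (φ p)) := inferInstanceAs (FiniteDimensional ℝ E)
  haveI : CompleteSpace (tangentImage I J φ p) := FiniteDimensional.complete ℝ _
  inferInstance

/-- The operator `T` that sends a vector `U` tangent to the submanifold at `p` to the tangential
part of `F U`. The tangent space of `M` at `p` is identified with its image in the tangent space
of `N` at `φ p`, and `T` is written on the whole of the latter. -/
def tangentialPart (φ : M → N) (F : ∀ x : N, TangentSpace J x →L[ℝ] TangentSpace J x) (p : M) :
    TangentSpace J (φ p) →L[ℝ] TangentSpace J (φ p) :=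
  (tangentImage I J φ p).starProjection ∘L F (φ p)

/-- The subspace `D^c = Ker (T² - c² I)` of the tangent space of `M` at `p`. -/
def slantSpace (φ : M → N) (F : ∀ x : N, TangentSpace J x →L[ℝ] TangentSpace J x) (c : ℝ)
    (p : M) : Submodule ℝ (TangentSpace I p) :=
  LinearMap.ker
    (((tangentialPart I J φ F p ∘L tangentialPart I J φ F p
      - (c ^ 2) • ContinuousLinearMap.id ℝ (TangentSpace J (φ p))) ∘L
        mfderiv I J φ p).toLinearMap)

/-- The anti-invariant distribution `D^⊥ = D^0`. -/
def antiInvariantDistribution (φ : M → N)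
    (F : ∀ x : N, TangentSpace J x →L[ℝ] TangentSpace J x) (p : M) :
    Submodule ℝ (TangentSpace I p) :=
  slantSpace I J φ F 0 p

/-- The invariant distribution `D^T = D^1`. -/
def invariantDistribution (φ : M → N)
    (F : ∀ x : N, TangentSpace J x →L[ℝ] TangentSpace J x) (p : M) :
    Submodule ℝ (TangentSpace I p) :=
  slantSpace I J φ F 1 p

/-- The submanifold given by `φ` is generic, with eigenvalue functions `lam i : M → (0, 1)`:
the `lam i p ^ 2` are distinct eigenvalues of `T_p²`, each tangent space of `M` is the direct sum
of `D^0`, `D^1` and the `D^{lam i}`, and the dimensions of these do not depend on the point. -/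
structure IsGenericSubmanifold (φ : M → N)
    (F : ∀ x : N, TangentSpace J x →L[ℝ] TangentSpace J x)
    {k : ℕ} (lam : Fin k → M → ℝ) : Prop where
  mem_Ioo : ∀ i p, lam i p ∈ Set.Ioo (0 : ℝ) 1
  distinct : ∀ p, Function.Injective (fun i => lam i p ^ 2)
  eigenvalue : ∀ i p, slantSpace I J φ F (lam i p) p ≠ ⊥
  directSum : ∀ p, DirectSum.IsInternal (fun i : Fin (k + 2) =>
    slantSpace I J φ F (Matrix.vecCons 0 (Matrix.vecCons 1 (fun j => lam j p)) i) p)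
  finrank_anti : ∀ p p', Module.finrank ℝ (antiInvariantDistribution I J φ F p) =
    Module.finrank ℝ (antiInvariantDistribution I J φ F p')
  finrank_inv : ∀ p p', Module.finrank ℝ (invariantDistribution I J φ F p) =
    Module.finrank ℝ (invariantDistribution I J φ F p')
  finrank_slant : ∀ i p p', Module.finrank ℝ (slantSpace I J φ F (lam i p) p) =
    Module.finrank ℝ (slantSpace I J φ F (lam i p') p')

/-- Skew semi-invariant submanifold of order `k`: a generic submanifold whose `k` eigenvalue
functions `lam i` are constant. -/
def IsSkewSemiInvariant (φ : M → N)
    (F : ∀ x : N, TangentSpace J x →L[ℝ] TangentSpace J x) (k : ℕ) : Prop :=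
  ∃ c : Fin k → ℝ, IsGenericSubmanifold I J φ F (fun i _ => c i)

/-- Proper skew semi-invariant submanifold of order `1`: `D^⊥ ≠ {0}` and `D^T ≠ {0}`. -/
def IsProperSkewSemiInvariantOrderOne (φ : M → N)
    (F : ∀ x : N, TangentSpace J x →L[ℝ] TangentSpace J x) : Prop :=
  IsSkewSemiInvariant I J φ F 1 ∧ ∀ p, antiInvariantDistribution I J φ F p ≠ ⊥ ∧
    invariantDistribution I J φ F p ≠ ⊥

/-- Hemi-slant submanifold: skew semi-invariant of order `1` with `D^T = {0}` and `D^⊥ ≠ {0}`. -/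
def IsHemiSlant (φ : M → N)
    (F : ∀ x : N, TangentSpace J x →L[ℝ] TangentSpace J x) : Prop :=
  IsSkewSemiInvariant I J φ F 1 ∧ ∀ p, antiInvariantDistribution I J φ F p ≠ ⊥ ∧
    invariantDistribution I J φ F p = ⊥

end Submanifold

section WarpedProduct

variable {E₁ : Type*} [NormedAddCommGroup E₁] [NormedSpace ℝ E₁]
  {H₁ : Type*} [TopologicalSpace H₁] (I₁ : ModelWithCorners ℝ E₁ H₁)
  {M₁ : Type*} [TopologicalSpace M₁] [ChartedSpace H₁ M₁]
  [RiemannianBundle (fun x : M₁ => TangentSpace I₁ x)]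
  {E₂ : Type*} [NormedAddCommGroup E₂] [NormedSpace ℝ E₂]
  {H₂ : Type*} [TopologicalSpace H₂] (I₂ : ModelWithCorners ℝ E₂ H₂)
  {M₂ : Type*} [TopologicalSpace M₂] [ChartedSpace H₂ M₂]
  [RiemannianBundle (fun x : M₂ => TangentSpace I₂ x)]

/-- The warped product metric `g = g₁ + f² g₂` on `M₁ × M₂`. -/
def warpedInner (f : M₁ → ℝ) (x : M₁ × M₂) (u v : TangentSpace (I₁.prod I₂) x) : ℝ :=
  inner ℝ (mfderiv (I₁.prod I₂) I₁ Prod.fst x u) (mfderiv (I₁.prod I₂) I₁ Prod.fst x v)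
    + f x.1 ^ 2 *
      inner ℝ (mfderiv (I₁.prod I₂) I₂ Prod.snd x u) (mfderiv (I₁.prod I₂) I₂ Prod.snd x v)

variable {E : Type*} [NormedAddCommGroup E] [NormedSpace ℝ E]
  {H : Type*} [TopologicalSpace H] (J : ModelWithCorners ℝ E H)
  {N : Type*} [TopologicalSpace N] [ChartedSpace H N]
  [RiemannianBundle (fun x : N => TangentSpace J x)]

/-- `φ` is a smooth isometric immersion into `N` of the warped product `M₁ ×_f M₂` with
smooth positive warping function `f`. -/
structure IsWarpedProductImmersion (f : M₁ → ℝ) (φ : M₁ × M₂ → N) : Prop where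
  smooth_warping : ContMDiff I₁ 𝓘(ℝ, ℝ) ∞ f
  warping_pos : ∀ x, 0 < f x
  smooth : ContMDiff (I₁.prod I₂) J ∞ φ
  isometric : ∀ (x : M₁ × M₂) (u v : TangentSpace (I₁.prod I₂) x),
    inner ℝ (mfderiv (I₁.prod I₂) J φ x u) (mfderiv (I₁.prod I₂) J φ x v)
      = warpedInner I₁ I₂ f x u v

end WarpedProduct

section Distribution

variable {E : Type*} [NormedAddCommGroup E] [NormedSpace ℝ E]
  {H : Type*} [TopologicalSpace H] (I : ModelWithCorners ℝ E H)
  {M : Type*} [TopologicalSpace M] [ChartedSpace H M] [IsManifold I 1 M]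

/-- The distribution `D` is involutive: the Lie bracket of two (locally defined) smooth vector
fields lying in `D` lies in `D`. -/
def IsInvolutiveDistribution (D : ∀ p : M, Submodule ℝ (TangentSpace I p)) : Prop :=
  ∀ (U : Set M), IsOpen U → ∀ X Y : ∀ p : M, TangentSpace I p,
    ContMDiffOn I I.tangent ∞ (fun p => (⟨p, X p⟩ : TangentBundle I M)) U →
    ContMDiffOn I I.tangent ∞ (fun p => (⟨p, Y p⟩ : TangentBundle I M)) U →
    (∀ p ∈ U, X p ∈ D p) → (∀ p ∈ U, Y p ∈ D p) →
    ∀ p ∈ U, VectorField.mlieBracket I X Y p ∈ D p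

/-- Through every point of `M` passes an integral manifold of `D`: an injectively immersed
submanifold whose tangent spaces are the spaces of `D`. It is taken small enough to be
parametrized by an open subset `U` of some `ℝᵏ`. -/
def HasIntegralManifolds (D : ∀ p : M, Submodule ℝ (TangentSpace I p)) : Prop :=
  ∀ p : M, ∃ (k : ℕ) (U : Set (EuclideanSpace ℝ (Fin k))) (ψ : EuclideanSpace ℝ (Fin k) → M),
    IsOpen U ∧ ContMDiffOn (𝓡 k) I ∞ ψ U ∧ Set.InjOn ψ U ∧ p ∈ ψ '' U ∧
    ∀ y ∈ U, Function.Injective (mfderiv (𝓡 k) I ψ y) ∧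
      LinearMap.range (mfderiv (𝓡 k) I ψ y).toLinearMap = D (ψ y)

/-- The distribution `D` is integrable: it is involutive and has an integral manifold through
every point. -/
def IsIntegrableDistribution (D : ∀ p : M, Submodule ℝ (TangentSpace I p)) : Prop :=
  IsInvolutiveDistribution I D ∧ HasIntegralManifolds I D

end Distribution

end

/-! The invariant distribution is exactly the distribution tangent to the fibres `{a} × M_T`, which
is integrable on any product manifold. At each point the warped metric splits the tangent space of
`M` orthogonally as `A ⊕ B`, with `A` tangent to the leaf and `B` to the fibre. Since `F` is an
isometric involution preserving `B`, it also preserves `Bᗮ ⊇ A`. Hence `T² = I` on `B`, and on `A`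
the operator `T` is the one belonging to the leaf (`sq_compression_sub_id_apply_add`). So a vector
lies in `D^T` iff its leaf component lies in `D^T` of the leaf, which is zero because the leaf is
hemi-slant. For the vertical distribution, charts of the fibre give the integral manifolds;
involutivity is read in a product chart, where differentiation preserves a vanishing first
component. -/

/-! ### Compression of an isometric involution to an orthogonal sum. -/

section OrthogonalSum

variable {V : Type*} [NormedAddCommGroup V] [InnerProductSpace ℝ V]
  {A B K : Submodule ℝ V} [A.HasOrthogonalProjection] [K.HasOrthogonalProjection]
  {F : V →L[ℝ] V}

/-- If `K` is the orthogonal sum of `A` and `B`, the orthogonal projection onto `K` agrees with the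
one onto `A` on the orthogonal complement of `B`. -/
lemma starProjection_sup_of_mem_orthogonal (hK : K = A ⊔ B) (hAB : A ⟂ B) {x : V} (hx : x ∈ Bᗮ) :
    K.starProjection x = A.starProjection x := by
  refine Submodule.eq_starProjection_of_mem_of_inner_eq_zero
    (hK ▸ Submodule.mem_sup_left (A.starProjection_apply_mem x)) fun w hw => ?_
  obtain ⟨a, ha, b, hb, rfl⟩ := Submodule.mem_sup.1 (hK ▸ hw)
  have h : inner ℝ (A.starProjection x) b = 0 :=
    Submodule.isOrtho_iff_inner_eq.1 hAB _ (A.starProjection_apply_mem x) _ hb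
  rw [inner_add_right, Submodule.starProjection_inner_eq_zero _ _ ha, inner_sub_left, h,
    Submodule.inner_left_of_mem_orthogonal hb hx]
  simp

/-- An isometric involution that preserves a subspace preserves its orthogonal complement. -/
lemma map_mem_orthogonal_of_involutive (hF : ∀ v, F (F v) = v)
    (hiso : ∀ u v, inner ℝ (F u) (F v) = inner ℝ u v) (hB : ∀ b ∈ B, F b ∈ B)
    {x : V} (hx : x ∈ Bᗮ) : F x ∈ Bᗮ := fun b hb => by
  -- Writing `b = F (F b)` makes `F` self-adjoint: `⟨b, F x⟩ = ⟨F b, x⟩`.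
  rw [← hF b, hiso]
  exact hx _ (hB b hb)

/-- If an isometric involution `F` preserves the summand `B` of an orthogonal sum `K = A ⊔ B`, the
fixed vectors of the square of the compression of `F` to `K` are those whose `A`-component is fixed
by the square of the compression of `F` to `A`. -/
lemma sq_compression_sub_id_apply_add (hK : K = A ⊔ B) (hAB : A ⟂ B) (hF : ∀ v, F (F v) = v)
    (hiso : ∀ u v, inner ℝ (F u) (F v) = inner ℝ u v) (hB : ∀ b ∈ B, F b ∈ B)
    {a b : V} (ha : a ∈ A) (hb : b ∈ B) :
    K.starProjection (F (K.starProjection (F (a + b)))) - (a + b) =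
      A.starProjection (F (A.starProjection (F a))) - a := by
  have key : ∀ x ∈ A, K.starProjection (F x) = A.starProjection (F x) := fun x hx =>
    starProjection_sup_of_mem_orthogonal hK hAB
      (map_mem_orthogonal_of_involutive hF hiso hB (hAB hx))
  have hKB : ∀ x ∈ B, K.starProjection (F x) = F x := fun x hx =>
    Submodule.starProjection_eq_self_iff.2 (hK ▸ Submodule.mem_sup_right (hB x hx))
  rw [map_add, map_add, map_add, map_add, key a ha, hKB b hb, hKB _ (hB b hb), hF,
    key _ (A.starProjection_apply_mem _)]
  abel

end OrthogonalSum

/-! ### Involutivity of the vertical distribution. -/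

section ProductManifold

variable {E₁ : Type*} [NormedAddCommGroup E₁] [NormedSpace ℝ E₁]
  {H₁ : Type*} [TopologicalSpace H₁] {I₁ : ModelWithCorners ℝ E₁ H₁}
  {M₁ : Type*} [TopologicalSpace M₁] [ChartedSpace H₁ M₁]
  {E₂ : Type*} [NormedAddCommGroup E₂] [NormedSpace ℝ E₂]
  {H₂ : Type*} [TopologicalSpace H₂] {I₂ : ModelWithCorners ℝ E₂ H₂}
  {M₂ : Type*} [TopologicalSpace M₂] [ChartedSpace H₂ M₂]

/-- The distribution on `M₁ × M₂` tangent to the fibres `{a} × M₂`. -/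
noncomputable def verticalDistribution (I₁ : ModelWithCorners ℝ E₁ H₁) (I₂ : ModelWithCorners ℝ E₂ H₂)
    (p : M₁ × M₂) : Submodule ℝ (TangentSpace (I₁.prod I₂) p) :=
  LinearMap.ker (mfderiv (I₁.prod I₂) I₁ Prod.fst p).toLinearMap

lemma mem_verticalDistribution {p : M₁ × M₂} {v : TangentSpace (I₁.prod I₂) p} :
    v ∈ verticalDistribution I₁ I₂ p ↔ v.1 = 0 := by
  rw [verticalDistribution, mfderiv_fst]
  rfl

/-- A field whose first component vanishes near `x` has derivative with vanishing first
component. -/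
lemma fst_fderivWithin_apply_eq_zero {E : Type*} [NormedAddCommGroup E] [NormedSpace ℝ E]
    {V : E → E₁ × E₂} {t : Set E} {x : E} (ht : UniqueDiffWithinAt ℝ t x) (hx : x ∈ t)
    (hV : ∀ᶠ y in nhdsWithin x t, (V y).1 = 0) (u : E) : (fderivWithin ℝ V t x u).1 = 0 := by
  by_cases h : DifferentiableWithinAt ℝ V t x
  · have h1 : HasFDerivWithinAt (fun y => (V y).1)
        ((ContinuousLinearMap.fst ℝ E₁ E₂).comp (fderivWithin ℝ V t x)) t x :=
      h.hasFDerivWithinAt.fst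
    have h2 : HasFDerivWithinAt (fun y => (V y).1) (0 : E →L[ℝ] E₁) t x :=
      (hasFDerivWithinAt_const (0 : E₁) x t).congr_of_eventuallyEq hV (hV.self_of_nhdsWithin hx)
    exact congrArg (fun L : E →L[ℝ] E₁ => L u) (ht.eq h1 h2)
  -- Without differentiability the derivative takes its default value `0`.
  · rw [fderivWithin_zero_of_not_differentiableWithinAt h]
    rfl

/-- The flat bracket is `DW(V) - DV(W)`, and each term has vanishing first component. -/
lemma fst_lieBracketWithin_eq_zero {V W : E₁ × E₂ → E₁ × E₂} {t : Set (E₁ × E₂)} {x : E₁ × E₂}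
    (ht : UniqueDiffWithinAt ℝ t x) (hx : x ∈ t) (hV : ∀ᶠ y in nhdsWithin x t, (V y).1 = 0)
    (hW : ∀ᶠ y in nhdsWithin x t, (W y).1 = 0) :
    (VectorField.lieBracketWithin ℝ V W t x).1 = 0 := by
  rw [VectorField.lieBracketWithin_eq, Prod.fst_sub, fst_fderivWithin_apply_eq_zero ht hx hW,
    fst_fderivWithin_apply_eq_zero ht hx hV, sub_zero]

variable [IsManifold I₁ 1 M₁] [IsManifold I₂ 1 M₂]

/-- A chart of the product is a product of charts, so it intertwines the two first projections; the
chain rule does the rest. This lets verticality be tested in coordinates. -/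
lemma fst_mfderiv_extChartAt_prod {x y : M₁ × M₂} (hy : y ∈ (extChartAt (I₁.prod I₂) x).source)
    (v : TangentSpace (I₁.prod I₂) y) :
    (mfderiv (I₁.prod I₂) 𝓘(ℝ, E₁ × E₂) (extChartAt (I₁.prod I₂) x) y v : E₁ × E₂).1 =
      mfderiv I₁ 𝓘(ℝ, E₁) (extChartAt I₁ x.1) y.1 v.1 := by
  have hy' : y ∈ (chartAt (ModelProd H₁ H₂) x).source := by rwa [← extChartAt_source (I₁.prod I₂)]
  have hy1 : y.1 ∈ (chartAt H₁ x.1).source := by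
    rw [prodChartedSpace_chartAt] at hy'
    exact hy'.1
  have h := mdifferentiableAt_extChartAt (I := I₁.prod I₂) hy'
  have h1 := mdifferentiableAt_extChartAt (I := I₁) hy1
  have e : (Prod.fst : E₁ × E₂ → E₁) ∘ extChartAt (I₁.prod I₂) x =
      extChartAt I₁ x.1 ∘ (Prod.fst : M₁ × M₂ → M₁) := by
    rw [extChartAt_prod]
    rfl
  have hl : mfderiv (I₁.prod I₂) 𝓘(ℝ, E₁) ((Prod.fst : E₁ × E₂ → E₁) ∘ extChartAt (I₁.prod I₂) x) y
      = (ContinuousLinearMap.fst ℝ E₁ E₂).comp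
        (mfderiv (I₁.prod I₂) 𝓘(ℝ, E₁ × E₂) (extChartAt (I₁.prod I₂) x) y) :=
    ((ContinuousLinearMap.fst ℝ E₁ E₂).hasMFDerivAt.comp y h.hasMFDerivAt).mfderiv
  have hr : mfderiv (I₁.prod I₂) 𝓘(ℝ, E₁) (extChartAt I₁ x.1 ∘ (Prod.fst : M₁ × M₂ → M₁)) y
      = (mfderiv I₁ 𝓘(ℝ, E₁) (extChartAt I₁ x.1) y.1).comp
        (ContinuousLinearMap.fst ℝ E₁ E₂) :=
    (h1.hasMFDerivAt.comp y (hasMFDerivAt_fst y)).mfderiv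
  rw [e] at hl
  exact congrArg (fun L : E₁ × E₂ →L[ℝ] E₁ => L v) (hl.symm.trans hr)

/-- The bracket of vector fields that are vertical near `p` is vertical at `p`. -/
lemma mlieBracket_mem_verticalDistribution {X Y : ∀ p : M₁ × M₂, TangentSpace (I₁.prod I₂) p}
    {p : M₁ × M₂} (hX : ∀ᶠ y in nhds p, X y ∈ verticalDistribution I₁ I₂ y)
    (hY : ∀ᶠ y in nhds p, Y y ∈ verticalDistribution I₁ I₂ y) :
    VectorField.mlieBracket (I₁.prod I₂) X Y p ∈ verticalDistribution I₁ I₂ p := by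
  set t : Set (E₁ × E₂) := Set.range (I₁.prod I₂) with ht
  set e := extChartAt (I₁.prod I₂) p with he
  have hp : p ∈ e.source := mem_extChartAt_source p
  -- Vertical fields read in the chart have zero first component.
  have pull : ∀ Z : ∀ p : M₁ × M₂, TangentSpace (I₁.prod I₂) p,
      (∀ᶠ y in nhds p, Z y ∈ verticalDistribution I₁ I₂ y) → ∀ᶠ z in nhdsWithin (e p) t,
        (VectorField.mpullbackWithin 𝓘(ℝ, E₁ × E₂) (I₁.prod I₂) e.symm Z t z : E₁ × E₂).1 = 0 := by
    intro Z hZ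
    have hcont : Filter.Tendsto e.symm (nhdsWithin (e p) t) (nhds p) := by
      have h := (continuousAt_extChartAt_symm (I := I₁.prod I₂) p).tendsto
      rw [extChartAt_to_inv] at h
      exact h.mono_left nhdsWithin_le_nhds
    filter_upwards [hcont.eventually hZ, extChartAt_target_mem_nhdsWithin (I := I₁.prod I₂) p]
      with z hz hzt
    have hi : (VectorField.mpullbackWithin 𝓘(ℝ, E₁ × E₂) (I₁.prod I₂) e.symm Z t z : E₁ × E₂) =
        mfderiv (I₁.prod I₂) 𝓘(ℝ, E₁ × E₂) e (e.symm z) (Z (e.symm z)) := by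
      -- Pulling back by `e.symm` inverts its derivative, which amounts to applying the derivative
      -- of `e`.
      refine ((isInvertible_mfderivWithin_extChartAt_symm hzt).inverse_apply_eq).2 ?_
      exact (congrArg (fun L : E₁ × E₂ →L[ℝ] E₁ × E₂ => L (Z (e.symm z)))
        (mfderivWithin_extChartAt_symm_comp_mfderiv_extChartAt hzt)).symm
    refine (congrArg Prod.fst hi).trans ((fst_mfderiv_extChartAt_prod (e.map_target hzt) _).trans ?_)
    exact (congrArg _ (mem_verticalDistribution.1 hz)).trans (map_zero _)
  have hmem : e p ∈ t := extChartAt_target_subset_range p (e.map_source hp)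
  have hw := fst_lieBracketWithin_eq_zero ((I₁.prod I₂).uniqueDiffOn _ hmem) hmem
    (pull X hX) (pull Y hY)
  -- The manifold bracket is the flat bracket carried back through the chart, so the derivative of
  -- `e` recovers the flat one.
  have hb : (mfderiv (I₁.prod I₂) 𝓘(ℝ, E₁ × E₂) e p
      (VectorField.mlieBracket (I₁.prod I₂) X Y p) : E₁ × E₂) = VectorField.lieBracketWithin ℝ
        (VectorField.mpullbackWithin 𝓘(ℝ, E₁ × E₂) (I₁.prod I₂) e.symm X t)
        (VectorField.mpullbackWithin 𝓘(ℝ, E₁ × E₂) (I₁.prod I₂) e.symm Y t) t (e p) := by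
    rw [← VectorField.mlieBracketWithin_univ, VectorField.mlieBracketWithin_apply, ← he,
      Set.preimage_univ, Set.univ_inter]
    exact (isInvertible_mfderiv_extChartAt (I := I₁.prod I₂) hp).self_apply_inverse _
  have h1 := fst_mfderiv_extChartAt_prod hp (VectorField.mlieBracket (I₁.prod I₂) X Y p)
  rw [mem_verticalDistribution]
  apply (isInvertible_mfderiv_extChartAt (I := I₁) (mem_extChartAt_source p.1)).injective
  exact (h1.symm.trans ((congrArg Prod.fst hb).trans hw)).trans (map_zero _).symm

end ProductManifold

/-! ### Fibres as integral manifolds. -/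

section VerticalIntegrable

variable {E₁ : Type*} [NormedAddCommGroup E₁] [NormedSpace ℝ E₁]
  {H₁ : Type*} [TopologicalSpace H₁] (I₁ : ModelWithCorners ℝ E₁ H₁)
  {M₁ : Type*} [TopologicalSpace M₁] [ChartedSpace H₁ M₁] {m : ℕ}
  {M₂ : Type*} [TopologicalSpace M₂] [ChartedSpace (EuclideanSpace ℝ (Fin m)) M₂]
  [IsManifold (𝓡 m) ∞ M₂]

/-- The fibres `{a} × M₂` are integral manifolds of the vertical distribution. -/
lemma hasIntegralManifolds_verticalDistribution :
    HasIntegralManifolds (I₁.prod (𝓡 m))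
      (fun p : M₁ × M₂ => verticalDistribution I₁ (𝓡 m) p) := by
  rintro ⟨a, b⟩
  have : IsManifold (𝓡 m) 1 M₂ := IsManifold.of_le (n := ∞) (by norm_cast)
  have hsmooth : ContMDiffOn (𝓡 m) (𝓡 m) ∞ (extChartAt (𝓡 m) b).symm (extChartAt (𝓡 m) b).target :=
    contMDiffOn_extChartAt_symm b
  have hopen : IsOpen (extChartAt (𝓡 m) b).target := isOpen_extChartAt_target b
  refine ⟨m, (extChartAt (𝓡 m) b).target, fun z => (a, (extChartAt (𝓡 m) b).symm z),
    hopen, contMDiffOn_const.prodMk hsmooth, ?_, ?_, ?_⟩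
  · intro z hz w hw h
    exact (extChartAt (𝓡 m) b).symm.injOn hz hw (congrArg Prod.snd h)
  · exact ⟨extChartAt (𝓡 m) b b, mem_extChartAt_target b, by simp⟩
  · intro z hz
    have hinv : (mfderiv (𝓡 m) (𝓡 m) (extChartAt (𝓡 m) b).symm z).IsInvertible := by
      have h := isInvertible_mfderivWithin_extChartAt_symm (I := 𝓡 m) hz
      -- The model is boundaryless, so the derivative within its range is the full derivative.
      rwa [(𝓡 m).range_eq_univ, mfderivWithin_univ] at h
    have hd : MDifferentiableAt (𝓡 m) (𝓡 m) (extChartAt (𝓡 m) b).symm z :=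
      (hsmooth.contMDiffAt (hopen.mem_nhds hz)).mdifferentiableAt (by simp)
    have hψ : ∀ v, mfderiv (𝓡 m) (I₁.prod (𝓡 m)) (fun z => (a, (extChartAt (𝓡 m) b).symm z)) z v =
        ((0 : E₁), mfderiv (𝓡 m) (𝓡 m) (extChartAt (𝓡 m) b).symm z v) := by
      intro v
      rw [mfderiv_prodMk mdifferentiableAt_const hd, mfderiv_const]
      rfl
    refine ⟨fun v w h => hinv.injective ?_, ?_⟩
    · exact congrArg Prod.snd ((hψ v).symm.trans (h.trans (hψ w)))
    · ext u
      rw [mem_verticalDistribution]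
      constructor
      · rintro ⟨v, rfl⟩
        exact congrArg Prod.fst (hψ v)
      · intro hu
        obtain ⟨v, hv⟩ := hinv.surjective u.2
        exact ⟨v, (hψ v).trans (Prod.ext hu.symm hv)⟩

/-- The vertical distribution of a product of manifolds is integrable. -/
lemma isIntegrableDistribution_verticalDistribution [IsManifold I₁ ∞ M₁]
    [IsManifold (I₁.prod (𝓡 m)) 1 (M₁ × M₂)] :
    IsIntegrableDistribution (I₁.prod (𝓡 m))
      (fun p : M₁ × M₂ => verticalDistribution I₁ (𝓡 m) p) := by
  have : IsManifold (𝓡 m) 1 M₂ := IsManifold.of_le (n := ∞) (by norm_cast)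
  have : IsManifold I₁ 1 M₁ := IsManifold.of_le (n := ∞) (by norm_cast)
  refine ⟨fun U hU X Y _ _ hX hY p hp => ?_, hasIntegralManifolds_verticalDistribution I₁⟩
  exact mlieBracket_mem_verticalDistribution
    (Filter.eventually_of_mem (hU.mem_nhds hp) hX) (Filter.eventually_of_mem (hU.mem_nhds hp) hY)

end VerticalIntegrable

/-! ### The invariant distribution of an immersed warped product. -/

section WarpedProductImmersion

variable {E₁ : Type*} [NormedAddCommGroup E₁] [NormedSpace ℝ E₁]
  {H₁ : Type*} [TopologicalSpace H₁] {I₁ : ModelWithCorners ℝ E₁ H₁}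
  {M₁ : Type*} [TopologicalSpace M₁] [ChartedSpace H₁ M₁]
  {E₂ : Type*} [NormedAddCommGroup E₂] [NormedSpace ℝ E₂]
  {H₂ : Type*} [TopologicalSpace H₂] {I₂ : ModelWithCorners ℝ E₂ H₂}
  {M₂ : Type*} [TopologicalSpace M₂] [ChartedSpace H₂ M₂]
  {E : Type*} [NormedAddCommGroup E] [NormedSpace ℝ E]
  {H : Type*} [TopologicalSpace H] {J : ModelWithCorners ℝ E H}
  {N : Type*} [TopologicalSpace N] [ChartedSpace H N]
  {φ : M₁ × M₂ → N}

/-- The tangent space of a product immersion is the sum of those of the leaf and of the fibre. -/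
lemma tangentImage_prod {p : M₁ × M₂} (hφ : MDifferentiableAt (I₁.prod I₂) J φ p) :
    tangentImage (I₁.prod I₂) J φ p =
      tangentImage I₁ J (fun a => φ (a, p.2)) p.1 ⊔ tangentImage I₂ J (fun b => φ (p.1, b)) p.2 := by
  apply le_antisymm
  · rintro _ ⟨v, rfl⟩
    refine Submodule.mem_sup.2 ⟨_, ⟨v.1, rfl⟩, _, ⟨v.2, rfl⟩, ?_⟩
    exact (mfderiv_prod_eq_add_apply hφ).symm
  · refine sup_le ?_ ?_
    · rintro _ ⟨v, rfl⟩
      refine ⟨(v, 0), (mfderiv_prod_eq_add_apply hφ).trans ?_⟩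
      exact (congrArg _ (map_zero (mfderiv I₂ J (fun b => φ (p.1, b)) p.2))).trans (add_zero _)
    · rintro _ ⟨v, rfl⟩
      refine ⟨(0, v), (mfderiv_prod_eq_add_apply hφ).trans ?_⟩
      exact (congrArg (· + _) (map_zero (mfderiv I₁ J (fun a => φ (a, p.2)) p.1))).trans (zero_add _)

variable [RiemannianBundle (fun x : N => TangentSpace J x)]
  {F : ∀ x : N, TangentSpace J x →L[ℝ] TangentSpace J x}

lemma mem_invariantDistribution_iff [FiniteDimensional ℝ E] {ψ : M₁ → N} {p : M₁} {v : TangentSpace I₁ p} :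
    v ∈ invariantDistribution I₁ J ψ F p ↔
      (tangentImage I₁ J ψ p).starProjection (F (ψ p) ((tangentImage I₁ J ψ p).starProjection
        (F (ψ p) (mfderiv I₁ J ψ p v)))) - mfderiv I₁ J ψ p v = 0 := by
  rw [invariantDistribution, slantSpace, one_pow, one_smul]
  rfl

variable [RiemannianBundle (fun x : M₁ => TangentSpace I₁ x)]
  [RiemannianBundle (fun x : M₂ => TangentSpace I₂ x)] {f : M₁ → ℝ}

/-- The leaves and the fibres of an immersed warped product are orthogonal. -/
lemma IsWarpedProductImmersion.isOrtho_tangentImage (hφ : IsWarpedProductImmersion I₁ I₂ J f φ)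
    (p : M₁ × M₂) :
    tangentImage I₁ J (fun a => φ (a, p.2)) p.1 ⟂ tangentImage I₂ J (fun b => φ (p.1, b)) p.2 := by
  have hd : MDifferentiableAt (I₁.prod I₂) J φ p := hφ.smooth.contMDiffAt.mdifferentiableAt (by simp)
  rw [Submodule.isOrtho_iff_inner_eq]
  rintro _ ⟨u, rfl⟩ _ ⟨v, rfl⟩
  have hu : mfderiv (I₁.prod I₂) J φ p (u, 0) = mfderiv I₁ J (fun a => φ (a, p.2)) p.1 u :=
    (mfderiv_prod_eq_add_apply hd).trans
      ((congrArg _ (map_zero (mfderiv I₂ J (fun b => φ (p.1, b)) p.2))).trans (add_zero _))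
  have hv : mfderiv (I₁.prod I₂) J φ p (0, v) = mfderiv I₂ J (fun b => φ (p.1, b)) p.2 v :=
    (mfderiv_prod_eq_add_apply hd).trans
      ((congrArg (· + _) (map_zero (mfderiv I₁ J (fun a => φ (a, p.2)) p.1))).trans (zero_add _))
  -- The warped metric has no mixed term: each of its two summands has a zero argument here.
  have h := hφ.isometric p (u, 0) (0, v)
  rw [hu, hv] at h
  unfold warpedInner at h
  rw [mfderiv_fst, mfderiv_snd] at h
  have h1 : (inner ℝ (u : TangentSpace I₁ p.1) (0 : TangentSpace I₁ p.1) : ℝ) = 0 :=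
    inner_zero_right _
  have h2 : (inner ℝ (0 : TangentSpace I₂ p.2) (v : TangentSpace I₂ p.2) : ℝ) = 0 :=
    inner_zero_left _
  exact h.trans ((congrArg₂ (fun s t : ℝ => s + f p.1 ^ 2 * t) h1 h2).trans (by simp))

/-- If the fibres of an immersed warped product are invariant, then a tangent vector lies in the
invariant distribution if and only if its component along the leaf lies in the invariant
distribution of the leaf. -/
lemma IsWarpedProductImmersion.mem_invariantDistribution_iff [FiniteDimensional ℝ E]
    (hφ : IsWarpedProductImmersion I₁ I₂ J f φ) (hsq : ∀ x v, F x (F x v) = v)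
    (hiso : ∀ x u v, inner ℝ (F x u) (F x v) = inner ℝ u v)
    (hinv : ∀ a : M₁, IsInvariantSubmanifold I₂ J (fun b => φ (a, b)) F)
    {p : M₁ × M₂} (v : TangentSpace (I₁.prod I₂) p) :
    v ∈ invariantDistribution (I₁.prod I₂) J φ F p ↔
      v.1 ∈ invariantDistribution I₁ J (fun a => φ (a, p.2)) F p.1 := by
  have hd : MDifferentiableAt (I₁.prod I₂) J φ p := hφ.smooth.contMDiffAt.mdifferentiableAt (by simp)
  have key := sq_compression_sub_id_apply_add (tangentImage_prod hd) (hφ.isOrtho_tangentImage p)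
    (hsq (φ p)) (hiso (φ p)) (hinv p.1 p.2) ⟨v.1, rfl⟩ ⟨v.2, rfl⟩
  -- Replaces the sum of the two partial derivatives by the full derivative of `φ` at `v`, so that
  -- `key` equates the two defects `T² - I`.
  replace key := (congrArg (fun x : TangentSpace J (φ p) =>
    (tangentImage (I₁.prod I₂) J φ p).starProjection (F (φ p)
      ((tangentImage (I₁.prod I₂) J φ p).starProjection (F (φ p) x))) - x)
    (mfderiv_prod_eq_add_apply (v := v) hd)).trans key
  refine (_root_.mem_invariantDistribution_iff (v := v)).trans
    (Iff.trans ?_ (_root_.mem_invariantDistribution_iff (v := v.1)).symm)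
  exact ⟨fun h => key.symm.trans h, fun h => key.trans h⟩

end WarpedProductImmersion

theorem theorem5p3 (q m : ℕ)
    -- the Riemannian manifold `M₁` of dimension `q`
    {M₁ : Type*} [TopologicalSpace M₁] [ChartedSpace (EuclideanSpace ℝ (Fin q)) M₁]
    [IsManifold (𝓡 q) ∞ M₁]
    [RiemannianBundle (fun x : M₁ => TangentSpace (𝓡 q) x)]
    [IsContMDiffRiemannianBundle (𝓡 q) ∞ (EuclideanSpace ℝ (Fin q))
      (fun x : M₁ => TangentSpace (𝓡 q) x)]
    -- the Riemannian manifold `M_T` of dimension `m`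
    {MT : Type*} [TopologicalSpace MT] [ChartedSpace (EuclideanSpace ℝ (Fin m)) MT]
    [IsManifold (𝓡 m) ∞ MT]
    [RiemannianBundle (fun x : MT => TangentSpace (𝓡 m) x)]
    [IsContMDiffRiemannianBundle (𝓡 m) ∞ (EuclideanSpace ℝ (Fin m))
      (fun x : MT => TangentSpace (𝓡 m) x)]
    -- the ambient locally product Riemannian manifold of dimension `2 q + m`
    {N : Type*} [TopologicalSpace N] [ChartedSpace (EuclideanSpace ℝ (Fin (2 * q + m))) N]
    [IsManifold (𝓡 (2 * q + m)) ∞ N]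
    [RiemannianBundle (fun x : N => TangentSpace (𝓡 (2 * q + m)) x)]
    [IsContMDiffRiemannianBundle (𝓡 (2 * q + m)) ∞ (EuclideanSpace ℝ (Fin (2 * q + m)))
      (fun x : N => TangentSpace (𝓡 (2 * q + m)) x)]
    (F : ∀ x : N, TangentSpace (𝓡 (2 * q + m)) x →L[ℝ] TangentSpace (𝓡 (2 * q + m)) x)
    (hF : IsLocallyProductRiemannian (𝓡 (2 * q + m)) F)
    -- the warped product submanifold `M = M₁ ×_f M_T`
    (f : M₁ → ℝ) (φ : M₁ × MT → N)
    (hφ : IsWarpedProductImmersion (𝓡 q) (𝓡 m) (𝓡 (2 * q + m)) f φ)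
    (hM : IsProperSkewSemiInvariantOrderOne ((𝓡 q).prod (𝓡 m)) (𝓡 (2 * q + m)) φ F)
    (hM₁ : ∀ b : MT, IsHemiSlant (𝓡 q) (𝓡 (2 * q + m)) (fun a : M₁ => φ (a, b)) F)
    (hMT : ∀ a : M₁, IsInvariantSubmanifold (𝓡 m) (𝓡 (2 * q + m)) (fun b : MT => φ (a, b)) F) :
    IsIntegrableDistribution ((𝓡 q).prod (𝓡 m))
      (invariantDistribution ((𝓡 q).prod (𝓡 m)) (𝓡 (2 * q + m)) φ F) := by
  have h : invariantDistribution ((𝓡 q).prod (𝓡 m)) (𝓡 (2 * q + m)) φ F =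
      fun p : M₁ × MT => verticalDistribution (𝓡 q) (𝓡 m) p := by
    funext p
    ext v
    -- Hemi-slantness makes `D^T` of the leaf `⊥`, leaving the condition `v.1 = 0` on both sides.
    rw [hφ.mem_invariantDistribution_iff hF.sq_eq hF.inner_eq hMT, ((hM₁ p.2).2 p.1).2,
      mem_verticalDistribution]
    rfl
  rw [h]
  exact isIntegrableDistribution_verticalDistribution (𝓡 q)
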